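/- For $-\frac{\pi}{2}<\beta<\frac{\pi}{2}$ and a bounded real potential $V=(V(n))_{n\ge 1}$, let $H_\beta^V$ be the bounded self-adjoint operator on $\ell^2(\mathbb{Z}^+)$, $\mathbb{Z}^+=\{1,2,3,\dots\}$, given by $$(H_\beta^V u)(n)=u(n+1)+u(n-1)+V(n)u(n),\quad n\ge 1,\qquad u(0)\cos\beta+u(1)\sin\beta=0,$$ and let $\mu^{\beta,V}$ be the spectral measure of $H_\beta^V$ associated with the vector $\delta_1$, i.e. the Borel measure on $\mathbb{R}$ with $\int f\,d\mu^{\beta,V}=\langle\delta_1,f(H_\beta^V)\delta_1\rangle$ for all compactly supported continuous $f$. **Theorem.** Let $b\in\ell^\infty(\mathbb{Z}^+,\mathbb{R})$ satisfy $|b(n)|\le C a^{-\tau n}$ for all $n\ge 1$, for some constants $C>0$, $a>3$, $\tau>4$. Then there exists $\epsilon>0$, depending only on $b$, such that for every real $\kappa$ with $|\kappa|<\epsilon$ there is a constant $\gamma>0$ such that, for every non-negative $f\in C([-2,2])$, (i) (Dirichlet case) $\displaystyle\int_{[-2,2]} f\,d\mu^{0,\kappa b}\le\gamma\int_{[-2,2]}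 f\,d\mu^{0,0}$, and (ii) ($\pi/4$ case) $\displaystyle\int_{[-2,2]} f\,d\mu^{\pi/4,\kappa b}\le\gamma\int_{[-2,2]} f\,d\big(\mu^{\pi/4,0}+\mu^{-\pi/4,0}\big)$. -/

import Mathlib

open MeasureTheory
open scoped InnerProductSpace ENNReal

/-- The Hilbert space `ℓ²(ℤ⁺)`, `ℤ⁺ = {1, 2, 3, …}`, with complex scalars. -/
abbrev HalfLineSpace : Type := lp (fun _ : ℕ+ => ℂ) 2

/-- Real bounded sequences on `ℤ⁺`, i.e. `ℓ^∞(ℤ⁺, ℝ)`. -/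
abbrev BoundedPotential : Type := lp (fun _ : ℕ+ => ℝ) ∞

noncomputable section

namespace HalfLine

/-- The extension of `u` from `{1, 2, …}` to `{0, 1, 2, …}`: the value at `0` is the one forced by
the boundary condition `u(0) cos β + u(1) sin β = 0` (for `cos β ≠ 0`). -/
def extend (β : ℝ) (u : ℕ+ → ℂ) : ℕ → ℂ
  | 0 => -(Real.tan β : ℂ) * u 1
  | k + 1 => u k.succPNat

theorem extend_coe (β : ℝ) (u : ℕ+ → ℂ) (n : ℕ+) : extend β u n = u n := by
  obtain ⟨k, rfl⟩ : ∃ k : ℕ, n = k.succPNat := ⟨n.natPred, by simp⟩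
  rfl

theorem extend_boundary {β : ℝ} (hβ : Real.cos β ≠ 0) (u : ℕ+ → ℂ) :
    extend β u 0 * (Real.cos β : ℂ) + extend β u 1 * (Real.sin β : ℂ) = 0 := by
  have h : (Real.cos β : ℂ) ≠ 0 := by exact_mod_cast hβ
  have h1 : extend β u 1 = u 1 := rfl
  have h0 : extend β u 0 = -(Real.tan β : ℂ) * u 1 := rfl
  rw [h0, h1, Real.tan_eq_sin_div_cos, Complex.ofReal_div]
  field_simp
  ring

/-- `(H u)(n) = u(n+1) + u(n-1) + V(n) u(n)` for `n ≥ 1`, where `u(0)` is given by the boundary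
condition with angle `β`. -/
def action (β : ℝ) (V : ℕ+ → ℝ) (u : ℕ+ → ℂ) (n : ℕ+) : ℂ :=
  extend β u ((n : ℕ) + 1) + extend β u ((n : ℕ) - 1) + (V n : ℂ) * u n

theorem summable_sq (u : HalfLineSpace) : Summable fun n : ℕ+ => ‖u n‖ ^ 2 := by
  have h := (memℓp_gen_iff (p := 2) (by simp)).1 (lp.memℓp u)
  simpa using h

theorem memℓp_of_summable_sq {u : ℕ+ → ℂ} (h : Summable fun n : ℕ+ => ‖u n‖ ^ 2) :
    Memℓp u 2 :=
  memℓp_gen (by simpa using h)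

theorem summable_succPNat {f : ℕ+ → ℝ} :
    Summable (fun k : ℕ => f k.succPNat) ↔ Summable f :=
  Equiv.summable_iff (Equiv.pnatEquivNat.symm) (f := f)

theorem summable_extend (β : ℝ) (u : HalfLineSpace) :
    Summable fun k : ℕ => ‖extend β u k‖ ^ 2 := by
  rw [← summable_nat_add_iff 1]
  exact summable_succPNat.2 (summable_sq u)

theorem action_memℓp (β : ℝ) (V : BoundedPotential) (u : HalfLineSpace) :
    Memℓp (action β V u) 2 := by
  have h1 : Memℓp (fun n : ℕ+ => extend β u ((n : ℕ) + 1)) 2 := by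
    apply memℓp_of_summable_sq
    rw [← summable_succPNat]
    exact (summable_nat_add_iff 2).2 (summable_extend β u)
  have h2 : Memℓp (fun n : ℕ+ => extend β u ((n : ℕ) - 1)) 2 := by
    apply memℓp_of_summable_sq
    rw [← summable_succPNat]
    exact summable_extend β u
  have h3 : Memℓp (fun n : ℕ+ => (V n : ℂ) * u n) 2 := by
    apply memℓp_of_summable_sq
    refine Summable.of_nonneg_of_le (fun n => by positivity) (fun n => ?_)
      ((summable_sq u).mul_left (‖V‖ ^ 2))
    rw [norm_mul, mul_pow, Complex.norm_real]
    gcongr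
    exact lp.norm_apply_le_norm (by simp) V n
  exact (h1.add h2).add h3

/-- The half-line Schrödinger operator as a linear map on `ℓ²(ℤ⁺)`. -/
def schrodingerLinear (β : ℝ) (V : BoundedPotential) : HalfLineSpace →ₗ[ℂ] HalfLineSpace where
  toFun u := ⟨action β V u, action_memℓp β V u⟩
  map_add' u v := by
    ext n
    obtain ⟨k, rfl⟩ : ∃ k : ℕ, n = k.succPNat := ⟨n.natPred, by simp⟩
    change action β V (fun m => u m + v m) _ = action β V u _ + action β V v _
    cases k <;> simp [action, extend] <;> ring
  map_smul' c u := by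
    ext n
    obtain ⟨k, rfl⟩ : ∃ k : ℕ, n = k.succPNat := ⟨n.natPred, by simp⟩
    change action β V (fun m => c * u m) _ = c * action β V u _
    cases k <;> simp [action, extend] <;> ring

theorem schrodingerLinear_isSymmetric (β : ℝ) (V : BoundedPotential) :
    (schrodingerLinear β V).IsSymmetric := by
  intro u v
  set e := extend β u with he
  set g := extend β v with hg
  have hs : ∀ i j : ℕ, Summable fun k : ℕ => g (k + i) * (starRingEnd ℂ) (e (k + j)) := by
    intro i j
    apply Summable.of_norm
    have h1 := (summable_nat_add_iff i).2 (summable_extend β v)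
    have h2 := (summable_nat_add_iff j).2 (summable_extend β u)
    refine Summable.of_nonneg_of_le (fun k => norm_nonneg _) (fun k => ?_) (h1.add h2)
    rw [norm_mul, RCLike.norm_conj]
    nlinarith [sq_nonneg (‖g (k + i)‖ - ‖e (k + j)‖), sq_nonneg ‖g (k + i)‖,
      sq_nonneg ‖e (k + j)‖]
  have hV : Summable fun k : ℕ =>
      (V k.succPNat : ℂ) * (g (k + 1) * (starRingEnd ℂ) (e (k + 1))) := by
    apply Summable.of_norm
    refine Summable.of_nonneg_of_le (fun k => norm_nonneg _) (fun k => ?_)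
      ((hs 1 1).norm.mul_left ‖V‖)
    rw [norm_mul, Complex.norm_real]
    gcongr
    exact lp.norm_apply_le_norm (by simp) V _
  rw [lp.inner_eq_tsum, lp.inner_eq_tsum, ← Equiv.tsum_eq Equiv.pnatEquivNat.symm,
    ← Equiv.tsum_eq Equiv.pnatEquivNat.symm]
  have hL : ∀ k : ℕ, ⟪schrodingerLinear β V u (Equiv.pnatEquivNat.symm k),
      v (Equiv.pnatEquivNat.symm k)⟫_ℂ =
      g (k + 1) * (starRingEnd ℂ) (e (k + 2)) + g (k + 1) * (starRingEnd ℂ) (e (k + 0))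
        + (V k.succPNat : ℂ) * (g (k + 1) * (starRingEnd ℂ) (e (k + 1))) := by
    intro k
    have h1 : v k.succPNat = g (k + 1) := rfl
    have h2 : schrodingerLinear β V u k.succPNat =
      e (k + 2) + e (k + 0) + (V k.succPNat : ℂ) * e (k + 1) := rfl
    rw [Equiv.pnatEquivNat_symm_apply, h1, h2]
    simp
    ring
  have hR : ∀ k : ℕ, ⟪u (Equiv.pnatEquivNat.symm k),
      schrodingerLinear β V v (Equiv.pnatEquivNat.symm k)⟫_ℂ =
      g (k + 2) * (starRingEnd ℂ) (e (k + 1)) + g (k + 0) * (starRingEnd ℂ) (e (k + 1))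
        + (V k.succPNat : ℂ) * (g (k + 1) * (starRingEnd ℂ) (e (k + 1))) := by
    intro k
    have h1 : u k.succPNat = e (k + 1) := rfl
    have h2 : schrodingerLinear β V v k.succPNat =
      g (k + 2) + g (k + 0) + (V k.succPNat : ℂ) * g (k + 1) := rfl
    rw [Equiv.pnatEquivNat_symm_apply, h1, h2]
    simp
    ring
  rw [tsum_congr hL, tsum_congr hR]
  rw [((hs 1 2).add (hs 1 0)).tsum_add hV, (hs 1 2).tsum_add (hs 1 0),
    ((hs 2 1).add (hs 0 1)).tsum_add hV, (hs 2 1).tsum_add (hs 0 1),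
    (hs 1 0).tsum_eq_zero_add, (hs 0 1).tsum_eq_zero_add]
  have hb : g (0 + 1) * (starRingEnd ℂ) (e (0 + 0)) =
      g (0 + 0) * (starRingEnd ℂ) (e (0 + 1)) := by
    have h1 : g (0 + 0) = -(Real.tan β : ℂ) * g 1 := rfl
    have h2 : e (0 + 0) = -(Real.tan β : ℂ) * e 1 := rfl
    rw [h1, h2, map_mul, map_neg, Complex.conj_ofReal]
    ring
  rw [hb]
  change _ + (_ + ∑' k : ℕ, g (k + 2) * (starRingEnd ℂ) (e (k + 1))) + _ =
    _ + (_ + ∑' k : ℕ, g (k + 1) * (starRingEnd ℂ) (e (k + 2))) + _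
  ring

/-- The half-line Schrödinger operator `H_β = △ + V` on `ℓ²(ℤ⁺)` with boundary condition
`u(0) cos β + u(1) sin β = 0` (`-π/2 < β < π/2`), as a bounded operator; the case `β = 0` is the
Dirichlet condition `u(0) = 0`. -/
def schrodinger (β : ℝ) (V : BoundedPotential) : HalfLineSpace →L[ℂ] HalfLineSpace :=
  ((schrodingerLinear_isSymmetric β V).toSelfAdjoint : HalfLineSpace →L[ℂ] HalfLineSpace)

theorem schrodinger_apply (β : ℝ) (V : BoundedPotential) (u : HalfLineSpace) (n : ℕ+) :
    schrodinger β V u n =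
      extend β u ((n : ℕ) + 1) + extend β u ((n : ℕ) - 1) + (V n : ℂ) * u n := rfl

theorem schrodinger_isSelfAdjoint (β : ℝ) (V : BoundedPotential) :
    IsSelfAdjoint (schrodinger β V) :=
  ((schrodingerLinear_isSymmetric β V).toSelfAdjoint).2

/-- The canonical basis vector `δ_1`. -/
def delta1 : HalfLineSpace := lp.single 2 (1 : ℕ+) (1 : ℂ)

end HalfLine

section SpectralMeasure

variable {E : Type*} [NormedAddCommGroup E] [InnerProductSpace ℂ E] [CompleteSpace E]

/-- The positive functional `f ↦ ⟨ψ, f(A) ψ⟩` on compactly supported continuous functions, where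
`f(A)` is the continuous functional calculus of the bounded self-adjoint operator `A`. -/
def spectralFunctional (A : E →L[ℂ] E) (ψ : E) : CompactlySupportedContinuousMap ℝ ℝ →ₚ[ℝ] ℝ :=
  PositiveLinearMap.mk₀
    { toFun := fun f => (⟪ψ, cfc (fun x : ℝ => f x) A ψ⟫_ℂ).re
      map_add' := fun f g => by
        have h : cfc (fun x : ℝ => (f + g) x) A = cfc (fun x : ℝ => f x) A +
            cfc (fun x : ℝ => g x) A :=
          cfc_add (R := ℝ) (a := A) (fun x => f x) (fun x => g x)
            f.continuous.continuousOn g.continuous.continuousOn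
        rw [h, add_apply, inner_add_right, Complex.add_re]
      map_smul' := fun c f => by
        have h : cfc (fun x : ℝ => (c • f) x) A = c • cfc (fun x : ℝ => f x) A :=
          cfc_smul (R := ℝ) (a := A) c (fun x => f x) f.continuous.continuousOn
        rw [h, smul_apply, RCLike.real_smul_eq_coe_smul (K := ℂ),
          inner_smul_right]
        simp }
    (fun f hf => by
      have h : 0 ≤ cfc (fun x : ℝ => f x) A := cfc_nonneg fun x _ => hf x
      exact ((ContinuousLinearMap.nonneg_iff_isPositive _).1 h).re_inner_nonneg_right ψ)

/-- The spectral measure `μ_ψ` of a bounded self-adjoint operator `A` and a vector `ψ`: the regular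
Borel measure on `ℝ` that represents `f ↦ ⟨ψ, f(A) ψ⟩`. -/
def spectralMeasure (A : E →L[ℂ] E) (ψ : E) : Measure ℝ :=
  RealRMK.rieszMeasure (spectralFunctional A ψ)

instance (A : E →L[ℂ] E) (ψ : E) : (spectralMeasure A ψ).Regular :=
  RealRMK.regular_rieszMeasure _

theorem integral_spectralMeasure (A : E →L[ℂ] E) (ψ : E)
    (f : CompactlySupportedContinuousMap ℝ ℝ) :
    ∫ x, f x ∂(spectralMeasure A ψ) = (⟪ψ, cfc (fun x : ℝ => f x) A ψ⟫_ℂ).re :=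
  RealRMK.integral_rieszMeasure _ f

end SpectralMeasure

/-- The half-line spectral measure `μ_{δ_1}^β` of `H_β = △ + V`. -/
def halfLineMeasure (β : ℝ) (V : BoundedPotential) : Measure ℝ :=
  spectralMeasure (HalfLine.schrodinger β V) HalfLine.delta1

end

/-!
The Poisson integrals of the two sides are compared, instead of their densities.

For `E = x + iy` with `x ∈ [-2, 2]` and `0 < y ≤ 1`, write `E = z + z⁻¹` with `0 < |z| < 1`. If
`(H_β - E) φ = c δ₁`, then `|c|² ∫ |t - E|⁻² dμ(t) = ‖φ‖²` for the spectral measure `μ` of `δ₁`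
(`normSq_mul_integral_spectralMeasure`). The free equation is solved by `φ₀(n) = zⁿ`. When the first
moment of the potential is small, which exponential decay allows for all small `κ`, a contraction
gives a perturbed solution `ψ(n) = zⁿ w(n)` with `|w - 1| ≤ 1/3` uniformly in `z`
(`exists_renormalized_jost_solution`), so `‖ψ‖` and `‖φ₀‖` are comparable. Only the defects
`c = -(ψ(0) + ψ(1) tan β)` in the boundary condition remain to be compared
(`poissonIntegral_halfLineMeasure_le`).

* In the Dirichlet case the defect is `ψ(0) = w(0)`, of modulus at least `2/3`, against `1` in the
  free case.
* For `β = π/4` the defect `J = ψ(0) + ψ(1)` is close to `1 + z` and may be small near `z = -1`.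
  Self-adjointness gives `y ‖ψ‖² ≤ |J| |ψ(1)|` (`HalfLine.im_mul_norm_sq_eq`), and
  `y ‖φ₀‖² = |Im z|` in the free case, hence `|J| ≥ |Im z| / 3`. The free defects for `±π/4` are
  `1 ± z`, and as `Re E ∈ [-2, 2]`, the smaller of them is at most `5 |Im z|`
  (`HalfLine.normSq_one_add_le_or`).

Finally, domination of Poisson integrals over `x ∈ [-2, 2]` for small `y` implies domination of the
measures on `[-2, 2]`, endpoints included, up to a factor `2`
(`setIntegral_le_of_poissonIntegral_le`). In this way neither boundary values of resolvents nor
the absence of eigenvalues at `±2` have to be discussed.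
-/

/-! ### Spectral measures and resolvents -/

section SpectralMeasureLemmas

variable {E : Type*} [NormedAddCommGroup E] [InnerProductSpace ℂ E] [CompleteSpace E]

theorem exists_spectrum_real_subset_closedBall (A : E →L[ℂ] E) :
    ∃ R : ℝ, spectrum ℝ A ⊆ Metric.closedBall 0 R :=
  ((ContinuousFunctionalCalculus.isCompact_spectrum (R := ℝ) (p := IsSelfAdjoint)
    A).isBounded).subset_closedBall 0

/-- The spectral measure is supported in every ball that contains the spectrum in its interior. -/
theorem spectralMeasure_ae_mem_closedBall {A : E →L[ℂ] E} (ψ : E) {R : ℝ}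
    (hR : spectrum ℝ A ⊆ Metric.closedBall 0 R) :
    ∀ᵐ t ∂(spectralMeasure A ψ), t ∈ Metric.closedBall (0 : ℝ) (R + 1) := by
  set K : ℕ → Set ℝ := fun n => Metric.closedBall 0 (n : ℝ) ∩ (Metric.ball 0 (R + 1))ᶜ with hK
  have hKn : ∀ n, spectralMeasure A ψ (K n) = 0 := by
    intro n
    have hc : IsCompact (K n) :=
      (isCompact_closedBall 0 (n : ℝ)).inter_right Metric.isOpen_ball.isClosed_compl
    have hd : Disjoint (K n) (Metric.closedBall (0 : ℝ) R) := by
      rw [Set.disjoint_left]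
      rintro t ⟨-, ht⟩ ht'
      simp only [Set.mem_compl_iff, mem_ball_zero_iff, mem_closedBall_zero_iff, not_lt] at ht ht'
      linarith
    obtain ⟨χ, h1, h0, hs, h01⟩ :=
      exists_continuous_one_zero_of_isCompact hc Metric.isClosed_closedBall hd
    let χ' : CompactlySupportedContinuousMap ℝ ℝ := ⟨χ, hs⟩
    have hint : ∫ t, χ' t ∂(spectralMeasure A ψ) = 0 := by
      rw [integral_spectralMeasure]
      have : cfc (fun x : ℝ => χ' x) A = cfc (fun _ : ℝ => (0 : ℝ)) A :=
        cfc_congr fun t ht => h0 (hR ht)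
      rw [this, cfc_const_zero]
      simp
    have hi : Integrable χ' (spectralMeasure A ψ) :=
      χ'.continuous.integrable_of_hasCompactSupport hs
    have hz := (integral_eq_zero_iff_of_nonneg (fun t => (h01 t).1) hi).1 hint
    refine measure_mono_null (fun t ht => ?_) hz
    have hχ : χ t = 1 := h1 ht
    simp [hχ]
  have hu := measure_iUnion_null hKn
  rw [ae_iff]
  refine measure_mono_null (fun t ht => ?_) hu
  simp only [mem_closedBall_zero_iff, not_le, Set.mem_ofPred_eq] at ht
  obtain ⟨n, hn⟩ := exists_nat_ge ‖t‖
  refine Set.mem_iUnion.2 ⟨n, ?_, ?_⟩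
  · simpa using hn
  · simp only [Set.mem_compl_iff, mem_ball_zero_iff, not_lt]
    exact ht.le

theorem isFiniteMeasure_spectralMeasure (A : E →L[ℂ] E) (ψ : E) :
    IsFiniteMeasure (spectralMeasure A ψ) := by
  obtain ⟨R, hR⟩ := exists_spectrum_real_subset_closedBall A
  refine ⟨?_⟩
  rw [← measure_add_measure_compl (μ := spectralMeasure A ψ)
    (Metric.isClosed_closedBall (x := (0 : ℝ)) (ε := R + 1)).measurableSet]
  have h := spectralMeasure_ae_mem_closedBall ψ hR
  rw [ae_iff] at h
  have h' : spectralMeasure A ψ (Metric.closedBall (0 : ℝ) (R + 1))ᶜ = 0 := h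
  rw [h', add_zero]
  exact (isCompact_closedBall (0 : ℝ) (R + 1)).measure_lt_top

/-- The defining identity of the spectral measure extends from compactly supported to arbitrary
continuous functions, because the spectrum is compact. -/
theorem integral_spectralMeasure_of_continuous (A : E →L[ℂ] E) (ψ : E)
    {g : ℝ → ℝ} (hg : Continuous g) :
    ∫ t, g t ∂(spectralMeasure A ψ) = (⟪ψ, cfc g A ψ⟫_ℂ).re := by
  obtain ⟨R, hR⟩ := exists_spectrum_real_subset_closedBall A
  obtain ⟨χ, h1, -, hs, -⟩ := exists_continuous_one_zero_of_isCompact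
    (isCompact_closedBall (0 : ℝ) (R + 1)) isClosed_empty (Set.disjoint_empty _)
  let G : CompactlySupportedContinuousMap ℝ ℝ := ⟨⟨fun t => χ t * g t, by fun_prop⟩, hs.mul_right⟩
  have hG : ∀ t ∈ Metric.closedBall (0 : ℝ) (R + 1), G t = g t := by
    intro t ht
    change χ t * g t = g t
    rw [h1 ht, Pi.one_apply, one_mul]
  have e1 : ∫ t, g t ∂(spectralMeasure A ψ) = ∫ t, G t ∂(spectralMeasure A ψ) := by
    refine integral_congr_ae ?_
    filter_upwards [spectralMeasure_ae_mem_closedBall ψ hR] with t ht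
    exact (hG t ht).symm
  have e2 : cfc g A = cfc (fun t : ℝ => G t) A :=
    cfc_congr fun t ht => (hG t (Metric.closedBall_subset_closedBall (by linarith) (hR ht))).symm
  rw [e1, e2, integral_spectralMeasure]

/-- If `(A - E) φ = c ψ` with `E = x + iy`, `y ≠ 0`, then
`|c|² ∫ |t - E|⁻² dμ_ψ(t) = ‖φ‖²`: this is `‖(A - E)⁻¹ ψ‖²` as a spectral integral. -/
theorem normSq_mul_integral_spectralMeasure {A : E →L[ℂ] E} (hA : IsSelfAdjoint A) {ψ φ : E}
    {x y : ℝ} (hy : y ≠ 0) {c : ℂ} (h : A φ - (⟨x, y⟩ : ℂ) • φ = c • ψ) :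
    ‖c‖ ^ 2 * ∫ t, ((t - x) ^ 2 + y ^ 2)⁻¹ ∂(spectralMeasure A ψ) = ‖φ‖ ^ 2 := by
  have hpos : ∀ t : ℝ, 0 < (t - x) ^ 2 + y ^ 2 := fun t => by positivity
  have hgc : Continuous fun t : ℝ => ((t - x) ^ 2 + y ^ 2)⁻¹ :=
    Continuous.inv₀ (by fun_prop) fun t => (hpos t).ne'
  rw [integral_spectralMeasure_of_continuous A ψ hgc]
  set g : ℝ → ℝ := fun t => ((t - x) ^ 2 + y ^ 2)⁻¹ with hg
  set G : E →L[ℂ] E := cfc g A with hG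
  -- `B` is the real part `A - x` of `A - E`
  set B : E →L[ℂ] E := cfc (fun t : ℝ => t - x) A with hB
  have hBA : B = A - (algebraMap ℝ (E →L[ℂ] E) x) := by
    rw [hB, cfc_sub (R := ℝ) (a := A) (fun t => t) (fun _ => x), cfc_id' ℝ A, cfc_const x A]
  have hcomm : G * B = B * G := cfc_commute_cfc g (fun t : ℝ => t - x) A
  have hone : B * (G * B) + y ^ 2 • G = 1 := by
    have hc1 : ContinuousOn g (spectrum ℝ A) := hgc.continuousOn
    rw [hG, hB, ← cfc_mul (R := ℝ) (a := A) g (fun t => t - x) hc1,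
      ← cfc_mul (R := ℝ) (a := A) (fun t => t - x) (fun t => g t * (t - x)) (by fun_prop)
        (hc1.mul (by fun_prop)),
      ← cfc_smul (R := ℝ) (a := A) (y ^ 2) g hc1,
      ← cfc_add (R := ℝ) (a := A) (fun t => (t - x) * (g t * (t - x))) (fun t => y ^ 2 • g t)
        (ContinuousOn.mul (by fun_prop) (hc1.mul (by fun_prop))) (ContinuousOn.fun_const_smul hc1 (y ^ 2)),
      ← cfc_one ℝ A]
    refine cfc_congr fun t _ => ?_
    simp only [hg, smul_eq_mul, Pi.one_apply]
    have := (hpos t).ne'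
    field_simp
  have hBsa : IsSelfAdjoint B := cfc_predicate (R := ℝ) (fun t : ℝ => t - x) A
  have hsymm : ∀ u v : E, ⟪B u, v⟫_ℂ = ⟪u, B v⟫_ℂ := by
    intro u v
    exact hBsa.isSymmetric u v
  have hφ : c • ψ = B φ - (Complex.I * y) • φ := by
    rw [← h, hBA]
    have hE : (⟨x, y⟩ : ℂ) = x + Complex.I * y := by
      apply Complex.ext <;> simp
    rw [hE, add_smul, sub_apply, Algebra.algebraMap_eq_smul_one, smul_apply,
      one_apply_eq_self, sub_sub]
    congr 2
  have key : ⟪c • ψ, G (c • ψ)⟫_ℂ = ⟪φ, φ⟫_ℂ := by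
    have h1 : G (B φ) = B (G φ) := by
      have := congrArg (fun T : E →L[ℂ] E => T φ) hcomm
      simpa using this
    have h2 : B (G (B φ)) + ((y : ℂ) ^ 2) • G φ = φ := by
      have := congrArg (fun T : E →L[ℂ] E => T φ) hone
      have h3 : (y ^ 2 : ℝ) • G φ = ((y : ℂ) ^ 2) • G φ := by
        rw [← Complex.coe_smul]
        push_cast
        rfl
      simpa [h3] using this
    rw [hφ, map_sub, map_smul, inner_sub_left, inner_sub_right, inner_sub_right, hsymm, hsymm,
      map_smul, inner_smul_left, inner_smul_right, inner_smul_left, inner_smul_right, h1]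
    have h4 : ⟪φ, φ⟫_ℂ = ⟪φ, B (G (B φ))⟫_ℂ + (y : ℂ) ^ 2 * ⟪φ, G φ⟫_ℂ := by
      conv_lhs => rw [← h2]
      rw [inner_add_right, inner_smul_right]
      rw [h2]
    rw [h4, h1]
    simp only [map_mul, Complex.conj_I, Complex.conj_ofReal]
    linear_combination (-(y : ℂ) ^ 2 * ⟪φ, G φ⟫_ℂ) * Complex.I_sq
  have key' := congrArg Complex.re key
  rw [map_smul, inner_smul_left, inner_smul_right, ← mul_assoc, mul_comm ((starRingEnd ℂ) c),
    Complex.mul_conj, Complex.re_ofReal_mul, inner_self_eq_norm_sq_to_K, Complex.normSq_eq_norm_sq]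
    at key'
  rw [key']
  norm_cast

end SpectralMeasureLemmas

/-! ### Comparison of measures through their Poisson integrals -/

section PoissonComparison

open Filter Topology

/-- The limit as `y ↓ 0` of `∫ F(t + y s) (1 + s²)⁻¹ ds`, where `F` is the extension by zero of
a continuous function `f` on `[a, b]`: `π f(t)` inside, half of it at the endpoints, and zero
outside. -/
noncomputable def poissonBoundaryValue (a b : ℝ) (f : ℝ → ℝ) (t : ℝ) : ℝ :=
  ((Set.Ico a b).indicator f t + (Set.Ioc a b).indicator f t) * (Real.pi / 2)

theorem tendsto_integral_indicator_cauchy {a b : ℝ} (hab : a < b) {f : ℝ → ℝ}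
    (hf : Continuous f) {M : ℝ} (hM : ∀ x ∈ Set.Icc a b, |f x| ≤ M) (t : ℝ) {y : ℕ → ℝ}
    (hy : ∀ n, 0 < y n) (hy0 : Tendsto y atTop (𝓝 0)) :
    Tendsto (fun n => ∫ s, (Set.Icc a b).indicator f (t + y n * s) * (1 + s ^ 2)⁻¹) atTop
      (𝓝 (poissonBoundaryValue a b f t)) := by
  have hM0 : 0 ≤ M := (abs_nonneg _).trans (hM a ⟨le_rfl, hab.le⟩)
  have hval : poissonBoundaryValue a b f t = ∫ s : ℝ,
      ((Set.Ioi (0 : ℝ)).indicator (fun s => (Set.Ico a b).indicator f t * (1 + s ^ 2)⁻¹) s +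
      (Set.Iic (0 : ℝ)).indicator (fun s => (Set.Ioc a b).indicator f t * (1 + s ^ 2)⁻¹) s) := by
    rw [integral_add, integral_indicator measurableSet_Ioi, integral_indicator measurableSet_Iic,
      integral_const_mul, integral_const_mul, integral_Ioi_inv_one_add_sq,
      integral_Iic_inv_one_add_sq]
    · simp [poissonBoundaryValue]
      ring
    · exact (integrable_inv_one_add_sq.const_mul _).indicator measurableSet_Ioi
    · exact (integrable_inv_one_add_sq.const_mul _).indicator measurableSet_Iic
  rw [hval]
  refine tendsto_integral_of_dominated_convergence (fun s => M * (1 + s ^ 2)⁻¹) (fun n => ?_)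
    (integrable_inv_one_add_sq.const_mul _) (fun n => ?_) ?_
  · have h1 : Measurable fun s : ℝ => (Set.Icc a b).indicator f (t + y n * s) :=
      (hf.measurable.indicator measurableSet_Icc).comp (by fun_prop)
    exact (h1.mul (by fun_prop)).aestronglyMeasurable
  · refine Eventually.of_forall fun s => ?_
    have h2 : 0 ≤ (1 + s ^ 2)⁻¹ := by positivity
    rw [norm_mul, Real.norm_of_nonneg h2]
    refine mul_le_mul_of_nonneg_right ?_ h2
    by_cases hs : t + y n * s ∈ Set.Icc a b
    · rw [Set.indicator_of_mem hs]
      exact hM _ hs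
    · rw [Set.indicator_of_notMem hs]
      simpa using hM0
  · have hne : ∀ᵐ s : ℝ, s ≠ 0 := by
      simp [ae_iff]
    filter_upwards [hne] with s hs
    have hu : Tendsto (fun n => t + y n * s) atTop (𝓝 t) := by
      simpa using (hy0.mul_const s).const_add t
    have hfu : Tendsto (fun n => f (t + y n * s)) atTop (𝓝 (f t)) := (hf.tendsto t).comp hu
    rcases lt_or_gt_of_ne hs with hs | hs
    · have hlt : ∀ n, t + y n * s < t := fun n => by nlinarith [hy n]
      rw [Set.indicator_of_notMem (by simp [hs.le]), Set.indicator_of_mem (by simp [hs.le]),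
        zero_add]
      refine Tendsto.mul_const _ ?_
      by_cases ht : t ∈ Set.Ioc a b
      · rw [Set.indicator_of_mem ht]
        refine hfu.congr' ?_
        filter_upwards [hu.eventually (lt_mem_nhds ht.1)] with n hn
        exact (Set.indicator_of_mem (s := Set.Icc a b) ⟨hn.le, (hlt n).le.trans ht.2⟩ f).symm
      · rw [Set.indicator_of_notMem ht]
        refine tendsto_const_nhds.congr' ?_
        rw [Set.mem_Ioc, not_and_or, not_lt, not_le] at ht
        rcases ht with ht | ht
        · refine Eventually.of_forall fun n => ?_
          refine (Set.indicator_of_notMem ?_ f).symm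
          exact fun h => absurd h.1 (not_le.2 ((hlt n).trans_le ht))
        · filter_upwards [hu.eventually (lt_mem_nhds ht)] with n hn
          refine (Set.indicator_of_notMem ?_ f).symm
          exact fun h => absurd h.2 (not_le.2 hn)
    · have hlt : ∀ n, t < t + y n * s := fun n => by nlinarith [mul_pos (hy n) hs]
      rw [Set.indicator_of_mem (Set.mem_Ioi.2 hs),
        Set.indicator_of_notMem (s := Set.Iic (0 : ℝ)) (not_le.2 hs), add_zero]
      refine Tendsto.mul_const _ ?_
      by_cases ht : t ∈ Set.Ico a b
      · rw [Set.indicator_of_mem ht]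
        refine hfu.congr' ?_
        filter_upwards [hu.eventually (gt_mem_nhds ht.2)] with n hn
        exact (Set.indicator_of_mem (s := Set.Icc a b) ⟨ht.1.trans (hlt n).le, hn.le⟩ f).symm
      · rw [Set.indicator_of_notMem ht]
        refine tendsto_const_nhds.congr' ?_
        rw [Set.mem_Ico, not_and_or, not_le, not_lt] at ht
        rcases ht with ht | ht
        · filter_upwards [hu.eventually (gt_mem_nhds ht)] with n hn
          refine (Set.indicator_of_notMem ?_ f).symm
          exact fun h => absurd h.1 (not_le.2 hn)
        · refine Eventually.of_forall fun n => ?_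
          refine (Set.indicator_of_notMem ?_ f).symm
          exact fun h => absurd h.2 (not_le.2 (ht.trans_lt (hlt n)))

theorem integral_indicator_cauchy_eq (a b : ℝ) (f : ℝ → ℝ) (t : ℝ) {y : ℝ} (hy : 0 < y) :
    ∫ s, (Set.Icc a b).indicator f (t + y * s) * (1 + s ^ 2)⁻¹ =
      y * ∫ x in Set.Icc a b, f x * ((t - x) ^ 2 + y ^ 2)⁻¹ := by
  rw [← integral_indicator measurableSet_Icc]
  set G : ℝ → ℝ := (Set.Icc a b).indicator fun x => f x * ((t - x) ^ 2 + y ^ 2)⁻¹ with hG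
  have h1 : ∀ s : ℝ, (Set.Icc a b).indicator f (t + y * s) * (1 + s ^ 2)⁻¹ =
      y ^ 2 * G (t + y * s) := by
    intro s
    by_cases hs : t + y * s ∈ Set.Icc a b
    · simp only [hG, Set.indicator_of_mem hs]
      have : (t - (t + y * s)) ^ 2 + y ^ 2 = y ^ 2 * (1 + s ^ 2) := by ring
      rw [this, mul_inv]
      field_simp
    · simp [hG, Set.indicator_of_notMem hs]
  simp_rw [h1]
  rw [integral_const_mul, Measure.integral_comp_mul_left (fun u => G (t + u)) y,
    integral_add_left_eq_self G t, abs_of_pos (inv_pos.2 hy), smul_eq_mul]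
  field_simp

/-- If on `[a, b]` the Poisson integrals of `μ` are dominated by those of `ν`, then `μ` is dominated
by `ν` on `[a, b]`. The factor `2` covers the endpoints, where the Poisson integral of a function
supported in `[a, b]` only recovers half of its value. -/
theorem setIntegral_le_of_poissonIntegral_le {μ ν : Measure ℝ} [IsFiniteMeasure μ]
    [IsFiniteMeasure ν] {a b : ℝ} (hab : a < b) {γ : ℝ} (hγ : 0 ≤ γ)
    (h : ∀ x ∈ Set.Icc a b, ∀ y : ℝ, 0 < y → y ≤ 1 →
      ∫ t, ((t - x) ^ 2 + y ^ 2)⁻¹ ∂μ ≤ γ * ∫ t, ((t - x) ^ 2 + y ^ 2)⁻¹ ∂ν)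
    {f : ℝ → ℝ} (hf : ContinuousOn f (Set.Icc a b)) (hf0 : ∀ x ∈ Set.Icc a b, 0 ≤ f x) :
    ∫ x in Set.Icc a b, f x ∂μ ≤ 2 * γ * ∫ x in Set.Icc a b, f x ∂ν := by
  -- replace `f` by a continuous function on the line
  obtain ⟨F, hF, hFf⟩ : ∃ F : ℝ → ℝ, Continuous F ∧ ∀ x ∈ Set.Icc a b, F x = f x :=
    ⟨Set.IccExtend hab.le ((Set.Icc a b).domRestrict f),
      (continuousOn_iff_continuous_domRestrict.1 hf).Icc_extend',
      fun x hx => Set.IccExtend_of_mem hab.le _ hx⟩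
  rw [← setIntegral_congr_fun measurableSet_Icc hFf, ← setIntegral_congr_fun measurableSet_Icc hFf]
  have hF0 : ∀ x ∈ Set.Icc a b, 0 ≤ F x := fun x hx => by rw [hFf x hx]; exact hf0 x hx
  clear hFf hf hf0 f
  obtain ⟨M, hM⟩ : ∃ M, ∀ x ∈ Set.Icc a b, |F x| ≤ M :=
    isCompact_Icc.exists_bound_of_continuousOn hF.continuousOn
  have hM0 : 0 ≤ M := (abs_nonneg _).trans (hM a ⟨le_rfl, hab.le⟩)
  set y : ℕ → ℝ := fun n => 1 / ((n : ℝ) + 1) with hy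
  have hypos : ∀ n, 0 < y n := fun n => Nat.one_div_pos_of_nat
  have hy1 : ∀ n, y n ≤ 1 := fun n => by
    rw [hy]
    simp only
    rw [div_le_one (by positivity)]
    linarith [Nat.cast_nonneg (α := ℝ) n]
  have hy0 : Tendsto y atTop (𝓝 0) := tendsto_one_div_add_atTop_nhds_zero_nat
  set Φ : ℕ → ℝ → ℝ := fun n t => ∫ s, (Set.Icc a b).indicator F (t + y n * s) * (1 + s ^ 2)⁻¹
    with hΦ
  have hcont : ∀ n, Continuous fun p : ℝ × ℝ => F p.2 * ((p.1 - p.2) ^ 2 + y n ^ 2)⁻¹ := by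
    intro n
    refine (hF.comp continuous_snd).mul (Continuous.inv₀ (by fun_prop) fun p => ?_)
    have := hypos n
    positivity
  have hswap : ∀ (m : Measure ℝ) [IsFiniteMeasure m] (n : ℕ), ∫ t, Φ n t ∂m =
      y n * ∫ x in Set.Icc a b, F x * ∫ t, ((t - x) ^ 2 + y n ^ 2)⁻¹ ∂m := by
    intro m _ n
    have h1 : ∀ t, Φ n t = y n * ∫ x in Set.Icc a b, F x * ((t - x) ^ 2 + y n ^ 2)⁻¹ :=
      fun t => integral_indicator_cauchy_eq a b F t (hypos n)
    simp_rw [h1]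
    rw [integral_const_mul, integral_integral_swap]
    · simp_rw [integral_const_mul]
    · refine Integrable.of_bound (hcont n).aestronglyMeasurable (M * (y n ^ 2)⁻¹) ?_
      have hae : ∀ᵐ p : ℝ × ℝ ∂(m.prod (volume.restrict (Set.Icc a b))), p.2 ∈ Set.Icc a b :=
        Measure.quasiMeasurePreserving_snd.ae (ae_restrict_mem measurableSet_Icc)
      filter_upwards [hae] with p hp
      have := hypos n
      have hk : 0 ≤ ((p.1 - p.2) ^ 2 + y n ^ 2)⁻¹ := by positivity
      rw [Function.uncurry, norm_mul, Real.norm_of_nonneg hk]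
      refine mul_le_mul ?_ ?_ hk hM0
      · exact hM _ hp
      · gcongr
        nlinarith [sq_nonneg (p.1 - p.2)]
  have hle : ∀ n, ∫ t, Φ n t ∂μ ≤ γ * ∫ t, Φ n t ∂ν := by
    intro n
    have hi : ∀ (m : Measure ℝ) [IsFiniteMeasure m], IntegrableOn
        (fun x => F x * ∫ t, ((t - x) ^ 2 + y n ^ 2)⁻¹ ∂m) (Set.Icc a b) := by
      intro m _
      have hc : Continuous fun x : ℝ => ∫ t, ((t - x) ^ 2 + y n ^ 2)⁻¹ ∂m := by
        have := hypos n
        refine continuous_of_dominated (bound := fun _ => (y n ^ 2)⁻¹) (fun x => ?_) (fun x => ?_)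
          (integrable_const _) ?_
        · exact (Continuous.inv₀ (by fun_prop) fun t => by positivity).aestronglyMeasurable
        · refine Eventually.of_forall fun t => ?_
          rw [Real.norm_of_nonneg (by positivity)]
          gcongr
          nlinarith [sq_nonneg (t - x)]
        · refine Eventually.of_forall fun t => ?_
          exact Continuous.inv₀ (by fun_prop) fun x => by positivity
      exact (hF.mul hc).integrableOn_Icc
    rw [hswap μ n, hswap ν n, mul_left_comm, ← integral_const_mul γ]
    refine mul_le_mul_of_nonneg_left ?_ (hypos n).le
    refine setIntegral_mono_on (hi μ) ((hi ν).const_mul γ) measurableSet_Icc fun x hx => ?_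
    rw [mul_left_comm]
    exact mul_le_mul_of_nonneg_left (h x hx _ (hypos n) (hy1 n)) (hF0 x hx)
  have hlim : ∀ (m : Measure ℝ) [IsFiniteMeasure m], Tendsto (fun n => ∫ t, Φ n t ∂m) atTop
      (𝓝 (∫ t, poissonBoundaryValue a b F t ∂m)) := by
    intro m _
    refine tendsto_integral_of_dominated_convergence (fun _ => M * Real.pi) (fun n => ?_)
      (integrable_const _) (fun n => Eventually.of_forall fun t => ?_)
      (Eventually.of_forall fun t => ?_)
    · have hm : StronglyMeasurable (Function.uncurry fun t s : ℝ =>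
          (Set.Icc a b).indicator F (t + y n * s) * (1 + s ^ 2)⁻¹) := by
        refine Measurable.stronglyMeasurable ?_
        exact ((hF.measurable.indicator measurableSet_Icc).comp (by fun_prop)).mul (by fun_prop)
      exact hm.integral_prod_right.aestronglyMeasurable
    · rw [← integral_univ_inv_one_add_sq, ← integral_const_mul]
      refine norm_integral_le_of_norm_le (integrable_inv_one_add_sq.const_mul _)
        (Eventually.of_forall fun s => ?_)
      have h2 : 0 ≤ (1 + s ^ 2)⁻¹ := by positivity
      rw [norm_mul, Real.norm_of_nonneg h2]
      refine mul_le_mul_of_nonneg_right ?_ h2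
      by_cases hs : t + y n * s ∈ Set.Icc a b
      · rw [Set.indicator_of_mem hs]
        exact hM _ hs
      · rw [Set.indicator_of_notMem hs]
        simpa using hM0
    · exact tendsto_integral_indicator_cauchy hab hF hM t hypos hy0
  have hfin := le_of_tendsto_of_tendsto' (hlim μ) ((hlim ν).const_mul γ) hle
  have hint : ∀ (m : Measure ℝ) [IsFiniteMeasure m] {s : Set ℝ}, MeasurableSet s → s ⊆ Set.Icc a b →
      Integrable (s.indicator F) m := by
    intro m _ s hs hsub
    exact (integrable_indicator_iff hs).2 (hF.integrableOn_Icc.mono_set hsub)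
  have hFint : ∀ (m : Measure ℝ) [IsFiniteMeasure m],
      Integrable (poissonBoundaryValue a b F) m := fun m _ =>
    ((hint m measurableSet_Ico Set.Ico_subset_Icc_self).add
      (hint m measurableSet_Ioc Set.Ioc_subset_Icc_self)).mul_const _
  have hIco0 : ∀ t, 0 ≤ (Set.Ico a b).indicator F t := fun t =>
    Set.indicator_nonneg (fun x hx => hF0 x (Set.Ico_subset_Icc_self hx)) t
  have hIoc0 : ∀ t, 0 ≤ (Set.Ioc a b).indicator F t := fun t =>
    Set.indicator_nonneg (fun x hx => hF0 x (Set.Ioc_subset_Icc_self hx)) t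
  have hle_Icc : ∀ {s : Set ℝ}, s ⊆ Set.Icc a b → ∀ t,
      s.indicator F t ≤ (Set.Icc a b).indicator F t := by
    intro s hs t
    by_cases ht : t ∈ s
    · rw [Set.indicator_of_mem ht, Set.indicator_of_mem (hs ht)]
    · rw [Set.indicator_of_notMem ht]
      exact Set.indicator_nonneg hF0 t
  have hIcoI := hle_Icc Set.Ico_subset_Icc_self
  have hIocI := hle_Icc Set.Ioc_subset_Icc_self
  have hsum : ∀ t, (Set.Icc a b).indicator F t ≤
      (Set.Ico a b).indicator F t + (Set.Ioc a b).indicator F t := by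
    intro t
    by_cases ht : t ∈ Set.Icc a b
    · rcases ht.2.lt_or_eq with hb | hb
      · have h1 : t ∈ Set.Ico a b := ⟨ht.1, hb⟩
        rw [Set.indicator_of_mem ht, Set.indicator_of_mem h1]
        linarith [hIoc0 t]
      · have h1 : t ∈ Set.Ioc a b := ⟨hb ▸ hab, hb.le⟩
        rw [Set.indicator_of_mem ht, Set.indicator_of_mem h1]
        linarith [hIco0 t]
    · rw [Set.indicator_of_notMem ht]
      exact add_nonneg (hIco0 t) (hIoc0 t)
  rw [← integral_indicator measurableSet_Icc, ← integral_indicator measurableSet_Icc]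
  have hpi := Real.pi_pos
  have hlow : (∫ t, (Set.Icc a b).indicator F t ∂μ) * (Real.pi / 2) ≤
      ∫ t, poissonBoundaryValue a b F t ∂μ := by
    rw [← integral_mul_const]
    refine integral_mono ((hint μ measurableSet_Icc le_rfl).mul_const _) (hFint μ) fun t => ?_
    exact mul_le_mul_of_nonneg_right (hsum t) (by positivity)
  have hupp : ∫ t, poissonBoundaryValue a b F t ∂ν ≤
      (∫ t, (Set.Icc a b).indicator F t ∂ν) * Real.pi := by
    rw [← integral_mul_const]
    refine integral_mono (hFint ν) ((hint ν measurableSet_Icc le_rfl).mul_const _) fun t => ?_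
    simp only [poissonBoundaryValue]
    nlinarith [hIcoI t, hIocI t]
  have hchain := hlow.trans (hfin.trans (mul_le_mul_of_nonneg_left hupp hγ))
  refine le_of_mul_le_mul_right ?_ (show 0 < Real.pi / 2 by positivity)
  linarith

end PoissonComparison

/-! ### Jost solutions -/

section JostSolution

open BoundedContinuousFunction

/-- The kernel `q_k = z + z³ + ⋯ + z^(2k-1)` of the Volterra equation
`w(n) = 1 - ∑_{m > n} q_{m-n} V(m) w(m)` for the renormalized Jost solution `w(n) = z⁻ⁿ ψ(n)`. -/
noncomputable def jostKernel (z : ℂ) (k : ℕ) : ℂ := ∑ j ∈ Finset.range k, z ^ (2 * j + 1)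

theorem jostKernel_succ (z : ℂ) (k : ℕ) :
    jostKernel z (k + 1) = jostKernel z k + z ^ (2 * k + 1) :=
  Finset.sum_range_succ _ _

theorem norm_jostKernel_le {z : ℂ} (hz : ‖z‖ ≤ 1) (k : ℕ) : ‖jostKernel z k‖ ≤ k := by
  refine (norm_sum_le _ _).trans ?_
  calc ∑ j ∈ Finset.range k, ‖z ^ (2 * j + 1)‖ ≤ ∑ j ∈ Finset.range k, (1 : ℝ) := by
        gcongr with j
        rw [norm_pow]
        exact pow_le_one₀ (norm_nonneg _) hz
    _ = k := by simp

variable {v : ℕ → ℝ} {z : ℂ}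

theorem norm_jostTerm_le (hz : ‖z‖ ≤ 1) (w : ℕ →ᵇ ℂ) (n k : ℕ) :
    ‖jostKernel z (k + 1) * (v (n + k) * w (n + k + 1))‖ ≤
      (((n + k : ℕ) : ℝ) + 1) * |v (n + k)| * ‖w‖ := by
  rw [norm_mul, norm_mul, Complex.norm_real, Real.norm_eq_abs, ← mul_assoc]
  gcongr
  · refine (norm_jostKernel_le hz _).trans ?_
    push_cast
    linarith [Nat.cast_nonneg (α := ℝ) n]
  · exact w.norm_coe_le_norm _

theorem summable_jostTerm (hv : Summable fun k : ℕ => ((k : ℝ) + 1) * |v k|) (hz : ‖z‖ ≤ 1)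
    (w : ℕ →ᵇ ℂ) (n : ℕ) :
    Summable fun k => jostKernel z (k + 1) * (v (n + k) * w (n + k + 1)) :=
  Summable.of_norm_bounded ((hv.comp_injective (add_right_injective n)).mul_right ‖w‖)
    fun k => norm_jostTerm_le hz w n k

theorem norm_tsum_jostTerm_le (hv : Summable fun k : ℕ => ((k : ℝ) + 1) * |v k|) (hz : ‖z‖ ≤ 1)
    (w : ℕ →ᵇ ℂ) (n : ℕ) :
    ‖∑' k, jostKernel z (k + 1) * (v (n + k) * w (n + k + 1))‖ ≤
      (∑' k : ℕ, ((k : ℝ) + 1) * |v k|) * ‖w‖ := by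
  have hinj := add_right_injective n
  refine (tsum_of_norm_bounded ((hv.comp_injective hinj).mul_right ‖w‖).hasSum
    fun k => norm_jostTerm_le hz w n k).trans ?_
  rw [tsum_mul_right]
  exact mul_le_mul_of_nonneg_right
    (tsum_comp_le_tsum_of_inj hv (fun k => by positivity) hinj) (norm_nonneg w)

/-- The renormalized Jost solution: for a potential with small first moment and `|z| ≤ 1` there is
a function `w` close to `1`, uniformly in `z`, such that `ψ(n) = zⁿ w(n)` solves
`ψ(n+2) + ψ(n) + v(n) ψ(n+1) = (z + z⁻¹) ψ(n+1)`. The Volterra equation for `w` is solved by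
contraction in the space of bounded sequences. -/
theorem exists_renormalized_jost_solution (hv : Summable fun k : ℕ => ((k : ℝ) + 1) * |v k|)
    (hsmall : ∑' k : ℕ, ((k : ℝ) + 1) * |v k| ≤ 1 / 4) (hz : ‖z‖ ≤ 1) :
    ∃ w : ℕ → ℂ, (∀ n, ‖w n - 1‖ ≤ 1 / 3) ∧
      ∀ n, z ^ 2 * w (n + 2) + w n + v n * (z * w (n + 1)) = (z ^ 2 + 1) * w (n + 1) := by
  have hbound : ∀ (w : ℕ →ᵇ ℂ) (n : ℕ),
      ‖∑' k, jostKernel z (k + 1) * (v (n + k) * w (n + k + 1))‖ ≤ 1 / 4 * ‖w‖ := fun w n =>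
    (norm_tsum_jostTerm_le hv hz w n).trans (by gcongr)
  let T : (ℕ →ᵇ ℂ) → (ℕ →ᵇ ℂ) := fun w => ofNormedAddCommGroupDiscrete
    (fun n => 1 - ∑' k, jostKernel z (k + 1) * (v (n + k) * w (n + k + 1))) (1 + 1 / 4 * ‖w‖)
    fun n => (norm_sub_le _ _).trans (by simpa using hbound w n)
  have hT : ∀ w n, T w n = 1 - ∑' k, jostKernel z (k + 1) * (v (n + k) * w (n + k + 1)) :=
    fun w n => rfl
  have hcontr : ContractingWith (1 / 4) T := by
    refine ⟨by norm_num, LipschitzWith.of_dist_le_mul fun w w' => ?_⟩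
    rw [dist_le (by positivity)]
    intro n
    rw [hT, hT, dist_sub_left, dist_eq_norm,
      ← (summable_jostTerm hv hz w n).tsum_sub (summable_jostTerm hv hz w' n)]
    have : ∀ k, jostKernel z (k + 1) * (v (n + k) * w (n + k + 1)) -
        jostKernel z (k + 1) * (v (n + k) * w' (n + k + 1)) =
        jostKernel z (k + 1) * (v (n + k) * (w - w') (n + k + 1)) := by
      intro k
      simp
      ring
    simp_rw [this]
    rw [dist_eq_norm w w']
    simpa using hbound (w - w') n
  set w := hcontr.fixedPoint with hw
  have hfix : ∀ n, w n = 1 - ∑' k, jostKernel z (k + 1) * (v (n + k) * w (n + k + 1)) := by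
    intro n
    have h := congrArg (fun u : ℕ →ᵇ ℂ => u n) hcontr.fixedPoint_isFixedPt.eq
    exact h.symm.trans (hT _ n)
  have hnorm : ‖w‖ ≤ 4 / 3 := by
    have : ‖w‖ ≤ 1 + 1 / 4 * ‖w‖ := by
      rw [norm_le (by positivity)]
      intro n
      rw [hfix]
      exact (norm_sub_le _ _).trans (by simpa using hbound w n)
    linarith
  refine ⟨w, fun n => ?_, fun n => ?_⟩
  · rw [hfix, sub_sub_cancel_left, norm_neg]
    exact (hbound w n).trans (by linarith)
  · -- the first differences `w(n+1) - w(n)` are the sums `D(n)`, which obey a one-step recursion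
    set c : ℕ → ℂ := fun m => v m * w (m + 1) with hc
    set D : ℕ → ℂ := fun m => ∑' k, z ^ (2 * k + 1) * c (m + k) with hD
    have hsum : ∀ m, Summable fun k => jostKernel z (k + 1) * c (m + k) :=
      summable_jostTerm hv hz w
    have hshift : ∀ m k, c (m + (k + 1)) = c (m + 1 + k) := fun m k => by
      rw [add_right_comm, add_assoc]
    have hq : ∀ m, Summable fun k => jostKernel z k * c (m + k) := by
      intro m
      rw [← summable_nat_add_iff 1]
      simpa only [hshift] using hsum (m + 1)
    have hdiff : ∀ m k, z ^ (2 * k + 1) * c (m + k) =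
        jostKernel z (k + 1) * c (m + k) - jostKernel z k * c (m + k) := by
      intro m k
      rw [jostKernel_succ]
      ring
    have hDsum : ∀ m, Summable fun k => z ^ (2 * k + 1) * c (m + k) := by
      intro m
      simpa only [hdiff] using (hsum m).sub (hq m)
    have hstep : ∀ m, w m = w (m + 1) - D m := by
      intro m
      have h1 : D m = ∑' k, jostKernel z (k + 1) * c (m + k) - ∑' k, jostKernel z k * c (m + k) := by
        rw [← (hsum m).tsum_sub (hq m)]
        exact tsum_congr (hdiff m)
      have h2 : ∑' k, jostKernel z k * c (m + k) =
          ∑' k, jostKernel z (k + 1) * c (m + 1 + k) := by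
        rw [(hq m).tsum_eq_zero_add]
        simp only [hshift]
        simp [jostKernel]
      rw [hfix m, hfix (m + 1), h1, h2]
      ring
    have hrec : D n = z * c n + z ^ 2 * D (n + 1) := by
      simp only [hD]
      rw [(hDsum n).tsum_eq_zero_add, ← tsum_mul_left]
      simp only [hshift]
      congr 1
      · simp
      · exact tsum_congr fun k => by ring
    have e0 := hstep n
    have e1 := hstep (n + 1)
    simp only [hc] at hrec
    linear_combination e0 - z ^ 2 * e1 - hrec

end JostSolution

/-! ### Resolvents of half-line operators through Jost solutions -/

namespace HalfLine

theorem norm_sq_eq_tsum (u : HalfLineSpace) : ‖u‖ ^ 2 = ∑' n, ‖u n‖ ^ 2 := by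
  have h := lp.norm_rpow_eq_tsum (p := 2) (by simp) u
  simpa using h

theorem norm_sq_le_of_forall_norm_le {u u' : HalfLineSpace} {C : ℝ}
    (h : ∀ n, ‖u n‖ ≤ C * ‖u' n‖) : ‖u‖ ^ 2 ≤ C ^ 2 * ‖u'‖ ^ 2 := by
  rw [norm_sq_eq_tsum, norm_sq_eq_tsum, ← tsum_mul_left]
  refine (summable_sq u).tsum_le_tsum (fun n => ?_) ((summable_sq u').mul_left _)
  rw [← mul_pow]
  exact pow_le_pow_left₀ (norm_nonneg _) (h n) 2

theorem inner_delta1 (u : HalfLineSpace) : ⟪u, delta1⟫_ℂ = (starRingEnd ℂ) (u 1) := by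
  rw [delta1, lp.inner_single_right]
  simp

theorem delta1_apply_one : delta1 1 = 1 := by
  simp [delta1]

theorem delta1_apply_of_ne {n : ℕ+} (hn : n ≠ 1) : delta1 n = 0 := by
  simp [delta1, hn]

/-- The imaginary part of `⟪u, (H - e) u⟫`, where `⟪u, H u⟫` is real: this bounds the right side
`c` from below in terms of `‖u‖` when `e` is not real. -/
theorem im_mul_norm_sq_eq {β : ℝ} {V : BoundedPotential} {u : HalfLineSpace} {e c : ℂ}
    (h : schrodinger β V u - e • u = c • delta1) :
    e.im * ‖u‖ ^ 2 = -(c * (starRingEnd ℂ) (u 1)).im := by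
  have h1 : (⟪u, schrodinger β V u⟫_ℂ).im = 0 := by
    have hs : ⟪schrodinger β V u, u⟫_ℂ = ⟪u, schrodinger β V u⟫_ℂ :=
      schrodingerLinear_isSymmetric β V u u
    rw [← inner_conj_symm] at hs
    exact Complex.conj_eq_iff_im.1 hs
  have h2 : ⟪u, schrodinger β V u⟫_ℂ = e * (‖u‖ ^ 2 : ℝ) + c * (starRingEnd ℂ) (u 1) := by
    rw [eq_add_of_sub_eq' h, inner_add_right, inner_smul_right, inner_smul_right, inner_delta1,
      inner_self_eq_norm_sq_to_K]
    norm_cast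
  rw [h2, Complex.add_im, Complex.im_mul_ofReal] at h1
  linarith

theorem memℓp_jost {z : ℂ} (hz : ‖z‖ < 1) {w : ℕ → ℂ} {C : ℝ} (hw : ∀ n, ‖w n‖ ≤ C) :
    Memℓp (fun n : ℕ+ => z ^ (n : ℕ) * w n) 2 := by
  apply memℓp_of_summable_sq
  have hg : Summable fun n : ℕ => (‖z‖ ^ 2) ^ n :=
    summable_geometric_of_lt_one (by positivity) (by nlinarith [norm_nonneg z])
  refine Summable.of_nonneg_of_le (fun n => by positivity) (fun n => ?_)
    ((hg.comp_injective PNat.coe_injective).mul_right (C ^ 2))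
  rw [norm_mul, norm_pow, mul_pow, ← pow_mul, mul_comm (n : ℕ) 2, pow_mul]
  exact mul_le_mul_of_nonneg_left (pow_le_pow_left₀ (norm_nonneg _) (hw _) 2)
    (pow_nonneg (sq_nonneg _) _)

/-- The Jost solution `ψ(n) = zⁿ w(n)` as an element of `ℓ²(ℤ⁺)`. -/
noncomputable def jostVector {z : ℂ} (hz : ‖z‖ < 1) {w : ℕ → ℂ} {C : ℝ}
    (hw : ∀ n, ‖w n‖ ≤ C) : HalfLineSpace :=
  ⟨fun n : ℕ+ => z ^ (n : ℕ) * w n, memℓp_jost hz hw⟩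

/-- A Jost solution `ψ` solves `(H_β - E) ψ = -(ψ(0) + ψ(1) tan β) δ₁`, `E = z + z⁻¹`: the right
side is the defect of `ψ` in the boundary condition. -/
theorem schrodinger_jostVector (β : ℝ) (V : BoundedPotential) {z : ℂ} (hz : ‖z‖ < 1)
    (hz0 : z ≠ 0) {w : ℕ → ℂ} {C : ℝ} (hw : ∀ n, ‖w n‖ ≤ C)
    (hrec : ∀ n : ℕ, z ^ 2 * w (n + 2) + w n + (V n.succPNat : ℝ) * (z * w (n + 1)) =
      (z ^ 2 + 1) * w (n + 1)) :
    schrodinger β V (jostVector hz hw) - (z + z⁻¹) • jostVector hz hw =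
      (-(w 0 + Real.tan β * (z * w 1))) • delta1 := by
  ext n
  obtain ⟨k, rfl⟩ : ∃ k : ℕ, n = k.succPNat := ⟨n.natPred, by simp⟩
  have hext : ∀ m : ℕ, extend β (jostVector hz hw) (m + 1) = z ^ (m + 1) * w (m + 1) :=
    fun m => rfl
  have hself : jostVector hz hw k.succPNat = z ^ (k + 1) * w (k + 1) := rfl
  change schrodinger β V (jostVector hz hw) k.succPNat -
    (z + z⁻¹) * jostVector hz hw k.succPNat = (-(w 0 + Real.tan β * (z * w 1))) * delta1 k.succPNat
  rw [schrodinger_apply, hself, Nat.succPNat_coe, Nat.succ_eq_add_one, Nat.add_sub_cancel, hext]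
  have hr := hrec k
  have hzi : z * z⁻¹ = 1 := mul_inv_cancel₀ hz0
  cases k with
  | zero =>
    have h1 : (0 : ℕ).succPNat = 1 := rfl
    have h0 : extend β (jostVector hz hw) 0 = -(Real.tan β : ℂ) * (z ^ 1 * w 1) := rfl
    rw [h0, h1, delta1_apply_one]
    rw [h1] at hr
    simp only [zero_add] at hr ⊢
    linear_combination hr - w 1 * hzi
  | succ m =>
    have hne : (m + 1).succPNat ≠ 1 := by
      intro h
      have := congrArg PNat.val h
      simp at this
    rw [hext, delta1_apply_of_ne hne]
    linear_combination z ^ (m + 1) * hr - z ^ (m + 1) * w (m + 2) * hzi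

theorem exists_norm_lt_one_add_inv_eq {e : ℂ} (he : e.im ≠ 0) :
    ∃ z : ℂ, ‖z‖ < 1 ∧ z ≠ 0 ∧ z + z⁻¹ = e := by
  obtain ⟨s, hs⟩ := IsAlgClosed.exists_pow_nat_eq (e ^ 2 - 4) (n := 2) (by norm_num)
  have hprod : (e + s) / 2 * ((e - s) / 2) = 1 := by linear_combination -hs / 4
  have hz0 : (e + s) / 2 ≠ 0 := left_ne_zero_of_mul_eq_one hprod
  have hinv : ((e + s) / 2)⁻¹ = (e - s) / 2 := inv_eq_of_mul_eq_one_right hprod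
  have hsum : (e + s) / 2 + ((e + s) / 2)⁻¹ = e := by rw [hinv]; ring
  generalize (e + s) / 2 = z at hz0 hsum
  rcases lt_trichotomy ‖z‖ 1 with h | h | h
  · exact ⟨z, h, hz0, hsum⟩
  · refine absurd ?_ he
    rw [← hsum, Complex.inv_eq_conj h]
    simp
  · refine ⟨z⁻¹, ?_, inv_ne_zero hz0, ?_⟩
    · rw [norm_inv]
      exact inv_lt_one_of_one_lt₀ h
    · rw [inv_inv, add_comm, hsum]

/-- For spectral parameters `E = z + z⁻¹` with real part in `[-2, 2]`, the point `z` can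
approach `±1` only away from the real axis: `|Im z|` controls the distance to the nearer of them. -/
theorem normSq_one_add_le_or {z : ℂ} (hz : ‖z‖ < 1) (hz0 : z ≠ 0)
    (hre : (z + z⁻¹).re ∈ Set.Icc (-2 : ℝ) 2) (him : |(z + z⁻¹).im| ≤ 1) :
    ‖1 + z‖ ^ 2 ≤ 25 * z.im ^ 2 ∨ ‖1 - z‖ ^ 2 ≤ 25 * z.im ^ 2 := by
  have hnorm : ‖z + z⁻¹‖ ≤ 3 :=
    (Complex.norm_le_abs_re_add_abs_im _).trans (by linarith [abs_le.2 hre])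
  have hinv : ‖z‖⁻¹ ≤ 4 := by
    rw [← norm_inv]
    have : ‖z⁻¹‖ ≤ ‖z + z⁻¹‖ + ‖z‖ := by simpa using norm_sub_le (z + z⁻¹) z
    linarith
  have hzpos : 0 < ‖z‖ := norm_pos_iff.2 hz0
  have hr : 1 / 4 ≤ ‖z‖ := by
    rw [inv_le_comm₀ hzpos (by norm_num)] at hinv
    linarith
  have hs : ‖z‖ ^ 2 = z.re ^ 2 + z.im ^ 2 := by
    rw [← Complex.normSq_eq_norm_sq, Complex.normSq_apply]
    ring
  have hs16 : 1 / 16 ≤ z.re ^ 2 + z.im ^ 2 := by nlinarith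
  have hspos : 0 < z.re ^ 2 + z.im ^ 2 := by linarith
  have hs1 : z.re ^ 2 + z.im ^ 2 < 1 := by nlinarith
  have hrez : (z + z⁻¹).re = z.re + z.re / (z.re ^ 2 + z.im ^ 2) := by
    rw [Complex.add_re, Complex.inv_re, Complex.normSq_eq_norm_sq, hs]
  rw [hrez] at hre
  have hp : ‖1 + z‖ ^ 2 = (1 + z.re) ^ 2 + z.im ^ 2 := by
    rw [← Complex.normSq_eq_norm_sq, Complex.normSq_apply]
    simp
    ring
  have hm : ‖1 - z‖ ^ 2 = (1 - z.re) ^ 2 + z.im ^ 2 := by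
    rw [← Complex.normSq_eq_norm_sq, Complex.normSq_apply]
    simp
    ring
  -- with `a = |Re z|`, the condition `|Re E| ≤ 2` amounts to `a (1 - a)² ≤ (2 - a) (Im z)²`
  have key : ∀ a q : ℝ, 0 ≤ a → 1 / 16 ≤ a ^ 2 + q ^ 2 → a ^ 2 + q ^ 2 < 1 →
      a + a / (a ^ 2 + q ^ 2) ≤ 2 → (1 - a) ^ 2 + q ^ 2 ≤ 25 * q ^ 2 := by
    intro a q ha h16 h1 h2
    have hpos : 0 < a ^ 2 + q ^ 2 := by linarith
    have h3 : a * (a ^ 2 + q ^ 2) + a ≤ 2 * (a ^ 2 + q ^ 2) := by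
      have := mul_le_mul_of_nonneg_right h2 hpos.le
      rwa [add_mul, div_mul_cancel₀ _ hpos.ne'] at this
    have h4 : a * (1 - a) ^ 2 ≤ (2 - a) * q ^ 2 := by linarith
    rcases le_total (1 / 8) a with h8 | h8
    · have h5 := mul_le_mul_of_nonneg_right h8 (sq_nonneg (1 - a))
      have h6 := mul_nonneg ha (sq_nonneg q)
      linarith [sq_nonneg q]
    · have h5 : a ^ 2 ≤ (1 / 8) ^ 2 := pow_le_pow_left₀ ha h8 2
      have h6 : (1 - a) ^ 2 ≤ 1 := pow_le_one₀ (by linarith) (by linarith)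
      linarith
  rw [hp, hm]
  rcases le_total 0 z.re with h | h
  · right
    exact key z.re z.im h hs16 hs1 hre.2
  · left
    have := key (-z.re) z.im (by linarith) (by simpa using hs16) (by simpa using hs1)
      (by rw [neg_sq, neg_div]; linarith [hre.1])
    rw [sub_neg_eq_add] at this
    exact this

end HalfLine

/-! ### Comparison with the free half-line measures -/

open HalfLine

instance (β : ℝ) (V : BoundedPotential) : IsFiniteMeasure (halfLineMeasure β V) :=
  isFiniteMeasure_spectralMeasure _ _

/-- If the first moment of `V` is small, then the Poisson integrals of the Dirichlet measure and of
the `π/4` measure are dominated by those of the corresponding free measures. -/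
theorem poissonIntegral_halfLineMeasure_le {V : BoundedPotential}
    (hV : Summable fun k : ℕ => ((k : ℝ) + 1) * |V k.succPNat|)
    (hsmall : ∑' k : ℕ, ((k : ℝ) + 1) * |V k.succPNat| ≤ 1 / 4) {x : ℝ}
    (hx : x ∈ Set.Icc (-2 : ℝ) 2) {y : ℝ} (hy : 0 < y) (hy1 : y ≤ 1) :
    ∫ t, ((t - x) ^ 2 + y ^ 2)⁻¹ ∂(halfLineMeasure 0 V) ≤
        400 * ∫ t, ((t - x) ^ 2 + y ^ 2)⁻¹ ∂(halfLineMeasure 0 0) ∧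
      ∫ t, ((t - x) ^ 2 + y ^ 2)⁻¹ ∂(halfLineMeasure (Real.pi / 4) V) ≤
        400 * (∫ t, ((t - x) ^ 2 + y ^ 2)⁻¹ ∂(halfLineMeasure (Real.pi / 4) 0) +
          ∫ t, ((t - x) ^ 2 + y ^ 2)⁻¹ ∂(halfLineMeasure (-(Real.pi / 4)) 0)) := by
  obtain ⟨z, hz, hz0, hE⟩ := exists_norm_lt_one_add_inv_eq (e := ⟨x, y⟩) hy.ne'
  obtain ⟨w, hw1, hwrec⟩ := exists_renormalized_jost_solution hV hsmall hz.le
  have hwU : ∀ n, ‖w n‖ ≤ 4 / 3 := fun n => by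
    have h : ‖w n‖ ≤ ‖w n - 1‖ + ‖(1 : ℂ)‖ := by simpa using norm_add_le (w n - 1) 1
    rw [norm_one] at h
    linarith [hw1 n]
  have hwL : ∀ n, 2 / 3 ≤ ‖w n‖ := fun n => by
    have h : ‖(1 : ℂ)‖ ≤ ‖w n - 1‖ + ‖w n‖ := by
      simpa [norm_sub_rev] using norm_add_le (1 - w n) (w n)
    rw [norm_one] at h
    linarith [hw1 n]
  have h1U : ∀ n : ℕ, ‖(fun _ : ℕ => (1 : ℂ)) n‖ ≤ 1 := by simp
  set φ := jostVector hz hwU with hφ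
  set φ₀ := jostVector hz h1U with hφ₀
  have hφapp : ∀ n : ℕ+, φ n = z ^ (n : ℕ) * w n := fun n => rfl
  have hφ₀app : ∀ n : ℕ+, φ₀ n = z ^ (n : ℕ) * 1 := fun n => rfl
  have heqV : ∀ β, schrodinger β V φ - (⟨x, y⟩ : ℂ) • φ =
      (-(w 0 + Real.tan β * (z * w 1))) • delta1 := fun β => by
    rw [← hE]
    exact schrodinger_jostVector β V hz hz0 hwU hwrec
  have heq0 : ∀ β, schrodinger β 0 φ₀ - (⟨x, y⟩ : ℂ) • φ₀ =
      (-(1 + Real.tan β * (z * 1))) • delta1 := fun β => by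
    rw [← hE]
    refine schrodinger_jostVector β 0 hz hz0 h1U fun n => ?_
    simp
  have hIV := fun β => normSq_mul_integral_spectralMeasure (schrodinger_isSelfAdjoint β V) hy.ne'
    (heqV β)
  have hI0 := fun β => normSq_mul_integral_spectralMeasure (schrodinger_isSelfAdjoint β 0) hy.ne'
    (heq0 β)
  have hnonneg : ∀ β W, 0 ≤ ∫ t, ((t - x) ^ 2 + y ^ 2)⁻¹ ∂(halfLineMeasure β W) :=
    fun β W => integral_nonneg fun t => by positivity
  change ∀ β, _ * ∫ t, ((t - x) ^ 2 + y ^ 2)⁻¹ ∂(halfLineMeasure β V) = _ at hIV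
  change ∀ β, _ * ∫ t, ((t - x) ^ 2 + y ^ 2)⁻¹ ∂(halfLineMeasure β 0) = _ at hI0
  have hupp : ‖φ‖ ^ 2 ≤ (4 / 3) ^ 2 * ‖φ₀‖ ^ 2 := by
    refine norm_sq_le_of_forall_norm_le fun n => ?_
    rw [hφapp, hφ₀app, mul_one, norm_mul, mul_comm]
    gcongr
    exact hwU _
  have hlow : ‖φ₀‖ ^ 2 ≤ (3 / 2) ^ 2 * ‖φ‖ ^ 2 := by
    refine norm_sq_le_of_forall_norm_le fun n => ?_
    rw [hφapp, hφ₀app, mul_one, norm_mul]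
    nlinarith [hwL n, norm_nonneg (z ^ (n : ℕ))]
  have hφ₀1 : φ₀ 1 = z := by simp [hφ₀app]
  have hφ1 : φ 1 = z * w 1 := by simp [hφapp]
  have hfree : y * ‖φ₀‖ ^ 2 = -z.im := by
    have h := im_mul_norm_sq_eq (heq0 0)
    rw [hφ₀1] at h
    simpa using h
  constructor
  · have hV0 := hIV 0
    have h00 := hI0 0
    simp only [Real.tan_zero, Complex.ofReal_zero, zero_mul, add_zero, norm_neg, norm_one,
      one_pow, one_mul] at hV0 h00
    have h1 : (2 / 3 : ℝ) ^ 2 ≤ ‖w 0‖ ^ 2 := by gcongr; exact hwL 0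
    have h2 := mul_le_mul_of_nonneg_right h1 (hnonneg 0 V)
    linarith [hnonneg 0 0]
  · have hVq := hIV (Real.pi / 4)
    have hp := hI0 (Real.pi / 4)
    have hm := hI0 (-(Real.pi / 4))
    have hher := im_mul_norm_sq_eq (heqV (Real.pi / 4))
    simp only [Real.tan_neg, Real.tan_pi_div_four, Complex.ofReal_neg, Complex.ofReal_one,
      one_mul, mul_one, neg_mul, norm_neg, ← sub_eq_add_neg] at hVq hp hm hher
    set J : ℂ := w 0 + z * w 1 with hJ
    -- self-adjointness keeps the boundary defect `J` away from zero off the real axis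
    have hJlow : |z.im| ≤ 3 * ‖J‖ := by
      have h1 : y * ‖φ‖ ^ 2 ≤ ‖J‖ * (4 / 3) := by
        rw [hher]
        refine (le_abs_self _).trans ?_
        rw [abs_neg]
        refine (Complex.abs_im_le_norm _).trans ?_
        rw [norm_neg, norm_mul, RCLike.norm_conj, hφ1, norm_mul]
        have : ‖z‖ * ‖w 1‖ ≤ 1 * (4 / 3) := by
          gcongr
          exact hwU 1
        rw [one_mul] at this
        gcongr
      have h2 : |z.im| = y * ‖φ₀‖ ^ 2 := by
        rw [hfree, ← abs_neg, abs_of_nonneg]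
        rw [← hfree]
        positivity
      have h3 := mul_le_mul_of_nonneg_left hlow hy.le
      rw [h2]
      linarith
    have hJsq : z.im ^ 2 ≤ 9 * ‖J‖ ^ 2 := by
      rw [← sq_abs]
      nlinarith [abs_nonneg z.im]
    have hIm : z.im ^ 2 * ∫ t, ((t - x) ^ 2 + y ^ 2)⁻¹ ∂(halfLineMeasure (Real.pi / 4) V) ≤
        16 * ‖φ₀‖ ^ 2 := by
      have h2 := mul_le_mul_of_nonneg_right hJsq (hnonneg (Real.pi / 4) V)
      linarith
    have hne : ∀ s : ℂ, ‖s‖ < 1 → 0 < ‖1 + s‖ ^ 2 := fun s hs => by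
      have : 1 + s ≠ 0 := fun h => by
        rw [eq_neg_of_add_eq_zero_right h, norm_neg, norm_one] at hs
        exact lt_irrefl _ hs
      positivity
    -- to be used for the free measure whose boundary defect `D` vanishes at the point of `±1`
    -- nearer to `z`; the constant is `400 = 16 * 25`
    have hcmp : ∀ D I : ℝ, 0 < D → D * I = ‖φ₀‖ ^ 2 → D ≤ 25 * z.im ^ 2 →
        ∫ t, ((t - x) ^ 2 + y ^ 2)⁻¹ ∂(halfLineMeasure (Real.pi / 4) V) ≤ 400 * I := by
      intro D I hD hDI hDz
      refine le_of_mul_le_mul_left ?_ hD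
      have h2 := mul_le_mul_of_nonneg_right hDz (hnonneg (Real.pi / 4) V)
      linarith
    have hre : (z + z⁻¹).re ∈ Set.Icc (-2 : ℝ) 2 := by rw [hE]; exact hx
    have him : |(z + z⁻¹).im| ≤ 1 := by
      rw [hE]
      exact abs_le.2 ⟨by linarith, hy1⟩
    rcases normSq_one_add_le_or hz hz0 hre him with h | h
    · linarith [hcmp _ _ (hne z hz) hp h, hnonneg (-(Real.pi / 4)) 0]
    · have hD : 0 < ‖1 - z‖ ^ 2 := by
        rw [sub_eq_add_neg]
        exact hne (-z) (by rwa [norm_neg])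
      linarith [hcmp _ _ hD hm h, hnonneg (Real.pi / 4) 0]

theorem summable_first_moment_of_exponential_decay {b : ℕ+ → ℝ} {C a τ : ℝ} (ha : 1 < a)
    (hτ : 0 < τ) (hb : ∀ n : ℕ+, |b n| ≤ C * a ^ (-(τ * (n : ℝ)))) :
    Summable fun k : ℕ => ((k : ℝ) + 1) * |b k.succPNat| := by
  have ha0 : 0 < a := by linarith
  set q : ℝ := a ^ (-τ) with hq
  have hq0 : 0 < q := Real.rpow_pos_of_pos ha0 _
  have hq1 : q < 1 := Real.rpow_lt_one_of_one_lt_of_neg ha (by linarith)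
  have hs : Summable fun n : ℕ => (n : ℝ) ^ 1 * q ^ n :=
    summable_pow_mul_geometric_of_norm_lt_one 1 (by rwa [Real.norm_of_nonneg hq0.le])
  refine Summable.of_nonneg_of_le (fun k => by positivity) (fun k => ?_)
    (((summable_nat_add_iff 1).2 hs).mul_left C)
  have h := hb k.succPNat
  have hpow : a ^ (-(τ * ((k.succPNat : ℕ) : ℝ))) = q ^ (k + 1) := by
    rw [hq, ← Real.rpow_natCast, ← Real.rpow_mul ha0.le, Nat.succPNat_coe, neg_mul]
  rw [hpow] at h
  calc ((k : ℝ) + 1) * |b k.succPNat| ≤ ((k : ℝ) + 1) * (C * q ^ (k + 1)) := by gcongr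
    _ = C * (((k + 1 : ℕ) : ℝ) ^ 1 * q ^ (k + 1)) := by push_cast; ring

theorem theorem2p12 (b : BoundedPotential)
    (hb : ∃ C a τ : ℝ, 0 < C ∧ 3 < a ∧ 4 < τ ∧ ∀ n : ℕ+, |b n| ≤ C * a ^ (-(τ * (n : ℝ)))) :
    ∃ ε : ℝ, 0 < ε ∧ ∀ κ : ℝ, |κ| < ε →
      ∃ γ : ℝ, 0 < γ ∧ ∀ f : ℝ → ℝ, ContinuousOn f (Set.Icc (-2) 2) →
        (∀ x ∈ Set.Icc (-2 : ℝ) 2, 0 ≤ f x) →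
          ∫ x in Set.Icc (-2 : ℝ) 2, f x ∂(halfLineMeasure 0 (κ • b)) ≤
              γ * ∫ x in Set.Icc (-2 : ℝ) 2, f x ∂(halfLineMeasure 0 0) ∧
          ∫ x in Set.Icc (-2 : ℝ) 2, f x ∂(halfLineMeasure (Real.pi / 4) (κ • b)) ≤
              γ * ∫ x in Set.Icc (-2 : ℝ) 2, f x
                ∂(halfLineMeasure (Real.pi / 4) 0 + halfLineMeasure (-(Real.pi / 4)) 0) := by
  obtain ⟨C, a, τ, -, ha, hτ, hbd⟩ := hb
  have hsum := summable_first_moment_of_exponential_decay (by linarith) (by linarith) hbd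
  set S : ℝ := ∑' k : ℕ, ((k : ℝ) + 1) * |b k.succPNat| with hS
  have hS0 : 0 ≤ S := tsum_nonneg fun k => by positivity
  refine ⟨1 / (4 * (S + 1)), by positivity, fun κ hκ => ⟨2 * 400, by norm_num, ?_⟩⟩
  have hterm : ∀ k : ℕ, ((k : ℝ) + 1) * |(κ • b) k.succPNat| =
      |κ| * (((k : ℝ) + 1) * |b k.succPNat|) := by
    intro k
    have : (κ • b) k.succPNat = κ * b k.succPNat := rfl
    rw [this, abs_mul]
    ring
  have hV : Summable fun k : ℕ => ((k : ℝ) + 1) * |(κ • b) k.succPNat| := by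
    simp_rw [hterm]
    exact hsum.mul_left _
  have hsmall : ∑' k : ℕ, ((k : ℝ) + 1) * |(κ • b) k.succPNat| ≤ 1 / 4 := by
    simp_rw [hterm]
    rw [tsum_mul_left]
    rw [lt_div_iff₀ (by positivity)] at hκ
    nlinarith [abs_nonneg κ]
  intro f hf hf0
  refine ⟨setIntegral_le_of_poissonIntegral_le (by norm_num) (by norm_num)
    (fun x hx y hy hy1 => (poissonIntegral_halfLineMeasure_le hV hsmall hx hy hy1).1) hf hf0,
    setIntegral_le_of_poissonIntegral_le (by norm_num) (by norm_num)
    (fun x hx y hy hy1 => ?_) hf hf0⟩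
  have hint : ∀ β, Integrable (fun t => ((t - x) ^ 2 + y ^ 2)⁻¹) (halfLineMeasure β 0) := by
    intro β
    refine Integrable.of_bound (Continuous.aestronglyMeasurable
      (Continuous.inv₀ (by fun_prop) fun t => by positivity)) (y ^ 2)⁻¹
      (Filter.Eventually.of_forall fun t => ?_)
    rw [Real.norm_of_nonneg (by positivity)]
    gcongr
    nlinarith [sq_nonneg (t - x)]
  rw [integral_add_measure (hint _) (hint _)]
  exact (poissonIntegral_halfLineMeasure_le hV hsmall hx hy hy1).2
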